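/- Let $\hat G$ be a category and let $G\subset\hat G$ be a monoid, i.e. a sub-category with a single object. Compositions are written in path order: $fg$ is defined when the target of $f$ is the source of $g$. Let $X$ be a $\delta$-hyperbolic geodesic metric space (for instance a $\delta$-hyperbolic complex; $X$ need not be proper) with a base point $P$, on which $\hat G$ acts on the left by isometries: every arrow of $\hat G$ acts as a distance-preserving map $X\to X$, identities act trivially, and $(fg).x=f.(g.x)$ whenever $fg$ is defined. Let $\mathcal S$ be a finite set of arrows of $\hat G$. *Automata.* Consider a deterministic finite state automaton over $\mathcal S$: a finite set of states with exactly one exiting edge for each state and each letter of $\mathcal S$, a start state which is not the target of any edge, a fail state which is not an accept state and all of whose exiting edges loop back to it, and a set of accept states. The *accessible states* are the non-fail states which can be reached from every non-fail state; with the edges connecting them they form the *accessible sub-automaton*. The automaton is *dominated* by its accessible sub-automaton if the latter is non-empty and recurrent (for some $l\ge 1$ there is a path of length exactly $l$ from each accessible state to each accessible state), and if the exponential growth rate $\limsup_n\frac1n\log a_n$ (where $\log 0=-\infty$) of the number $a_n$ of words of length $n$ which can be read along paths in the accessible sub-automaton is strictly larger than that of the number of words which can be read, from the start state, in the automaton with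 the accessible sub-automaton and the fail state removed. *Automatic normal form hypothesis.* Every $g\in G$ has a preferred word over $\mathcal S$ representing it, its *normal form*; the language of normal forms is exactly the language accepted by such an automaton; this automaton is dominated by its accessible sub-automaton; and there is a word $w_{\rm rigid}$ such that the paths traced out from the start state by $w_{\rm rigid}$ and by $w_{\rm rigid}^2$ end in the same accept state, which is accessible. *Geodesic words hypothesis.* There is a constant $R\ge 0$ such that for every normal form word $x_1x_2\cdots x_m$ and all $0\le i<j\le m$, the points $x_1\cdots x_k.P$ with $i\le k\le j$ all lie in the $R$-neighbourhood of every geodesic connecting $x_1\cdots x_i.P$ and $x_1\cdots x_j.P$. An arrow (in particular an element of $G$) acting on $X$ as $\phi$ acts *loxodromically* if $\lim_{n\to\infty}\frac1n d_X(P,\phi^n(P))$ exists and is positive. There are *interesting loxodromic actions* if there is a loop in the accessible sub-automaton such that the product of the letters read along this loop acts loxodromically on $X$. An element of $G$ with normal form $w$ is *rigid* if the word $w^n$ is accepted by the automaton for all $n\ge 1$. Let $B(l)$ be the set of elements of $G$ whose normal form has length at most $l$. **Theorem.** Suppose that the automatic normal form hypothesis and the geodesic words hypothesis are satisfied, and that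 there are interesting loxodromic actions. Then $$\liminf_{l\to\infty}\frac{\#\{g\in B(l): g\text{ is rigid and acts loxodromically on }X\}}{\#B(l)}>0.$$ -/

import Mathlib

open CategoryTheory Filter

universe u v w

namespace NormalForms

/-! ### Words in the arrows of a category and left actions of categories -/

section Words

variable {C : Type u} [Category.{v} C]

/-- `IsProduct x f`: the word `x = x₁ x₂ ⋯ xₖ` of arrows is composable (the target of each letter is
the source of the next one) and its product, read in path order, is the arrow `f`. -/
inductive IsProduct : List (Arrow C) → ∀ {a b : C}, (a ⟶ b) → Prop
  | nil (a : C) : IsProduct [] (𝟙 a)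
  | cons {a b c : C} (f : a ⟶ b) (g : b ⟶ c) (x : List (Arrow C)) :
      IsProduct x g → IsProduct (Arrow.mk f :: x) (f ≫ g)

variable (C) in
/-- A left action of the category `C` by isometries on a metric space `X`: every arrow acts as a
distance-preserving self-map of `X`, identities act trivially, and `(fg).x = f.(g.x)`, where `fg`
is the path-order composite (first `f`, then `g`). -/
structure IsometricAction (X : Type w) [MetricSpace X] where
  act : ∀ {a b : C}, (a ⟶ b) → X → X
  act_id : ∀ (a : C) (x : X), act (𝟙 a) x = x
  act_comp : ∀ {a b c : C} (f : a ⟶ b) (g : b ⟶ c) (x : X), act (f ≫ g) x = act f (act g x)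
  isometry : ∀ {a b : C} (f : a ⟶ b), Isometry (act f)

/-- `x₁ x₂ ⋯ xₖ . p = x₁.(x₂.(⋯ (xₖ.p)))`. -/
def IsometricAction.actWord {X : Type w} [MetricSpace X] (A : IsometricAction C X) :
    List (Arrow C) → X → X
  | [], p => p
  | f :: x, p => A.act f.hom (A.actWord x p)

theorem IsometricAction.act_eq_actWord {X : Type w} [MetricSpace X] (A : IsometricAction C X)
    {x : List (Arrow C)} {a b : C} {f : a ⟶ b} (h : IsProduct x f) (p : X) :
    A.act f p = A.actWord x p := by
  induction h with
  | nil a => exact A.act_id a p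
  | cons f g x _ ih => rw [A.act_comp, ih]; rfl

end Words

/-! ### Hyperbolic geometry -/

section Geometry

variable {X : Type w} [MetricSpace X]

/-- `σ` is (the image of) a geodesic connecting `x` and `y`. -/
def IsGeodesicSegment (σ : Set X) (x y : X) : Prop :=
  ∃ γ : ℝ → X, γ 0 = x ∧ γ (dist x y) = y ∧
    (∀ s ∈ Set.Icc 0 (dist x y), ∀ t ∈ Set.Icc 0 (dist x y), dist (γ s) (γ t) = |s - t|) ∧
    σ = γ '' Set.Icc 0 (dist x y)

variable (X) in
/-- Any two points are connected by a geodesic, and every geodesic triangle is `δ`-slim. -/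
def IsHyperbolicGeodesicSpace (δ : ℝ) : Prop :=
  (∀ x y : X, ∃ σ : Set X, IsGeodesicSegment σ x y) ∧
  ∀ (x y z : X) (σ₁ σ₂ σ₃ : Set X), IsGeodesicSegment σ₁ x y → IsGeodesicSegment σ₂ y z →
    IsGeodesicSegment σ₃ x z → ∀ p ∈ σ₁, ∃ q ∈ σ₂ ∪ σ₃, dist p q ≤ δ

/-- The self-map `φ` acts loxodromically: `d(P, φⁿ P) / n` converges to a positive limit. -/
def IsLoxodromic (P : X) (φ : X → X) : Prop :=
  ∃ τ : ℝ, 0 < τ ∧ Tendsto (fun n : ℕ => dist P (φ^[n] P) / n) atTop (nhds τ)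

end Geometry

/-! ### Automata -/

section Automata

variable {α : Type u} {Q : Type v}

/-- The conventions for automata: no arrow ends in the start state; all arrows leaving the fail
state loop back to it; the fail state is not an accept state. -/
structure IsFSA (M : DFA α Q) (fail : Q) : Prop where
  step_ne_start : ∀ (s : Q) (a : α), M.step s a ≠ M.start
  step_fail : ∀ a : α, M.step fail a = fail
  fail_notMem_accept : fail ∉ M.accept

/-- The accessible states: the non-fail states which can be reached from all non-fail states. -/
def accessible (M : DFA α Q) (fail : Q) : Set Q :=
  {s | s ≠ fail ∧ ∀ t, t ≠ fail → ∃ x : List α, M.evalFrom t x = s}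

/-- The words of length `n` that can be read along a path which starts in a state of `I` and all
of whose states belong to `T`. -/
def readable (M : DFA α Q) (I T : Set Q) (n : ℕ) : Set (List α) :=
  {x | x.length = n ∧ ∃ s ∈ I, ∀ y, y <+: x → M.evalFrom s y ∈ T}

/-- The exponential growth rate of the number of words in `readable M I T n`, on a logarithmic
scale: the upper limit of `(log #(readable M I T n)) / n`, in `[-∞, ∞]`. -/
noncomputable def growthRate (M : DFA α Q) (I T : Set Q) : EReal :=
  ExpGrowth.expGrowthSup fun n => ((readable M I T n).encard : ENNReal)

/-- For some `l ≥ 1` there is, between any two states of `T`, a path of length exactly `l`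
with all states in `T`. -/
def IsRecurrentOn (M : DFA α Q) (T : Set Q) : Prop :=
  ∃ l : ℕ, 0 < l ∧ ∀ s ∈ T, ∀ t ∈ T, ∃ x : List α, x.length = l ∧
    (∀ y, y <+: x → M.evalFrom s y ∈ T) ∧ M.evalFrom s x = t

/-- The automaton is dominated by its accessible sub-automaton: the latter is non-empty and
recurrent, and the number of words readable in it has a strictly larger exponential growth rate
than the number of words which can be read, from the start state, in the automaton with the
accessible sub-automaton and the fail state removed. -/
structure IsDominated (M : DFA α Q) (fail : Q) : Prop where
  nonempty : (accessible M fail).Nonempty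
  recurrent : IsRecurrentOn M (accessible M fail)
  growth : growthRate M {M.start} {s | s ≠ fail ∧ s ∉ accessible M fail} <
    growthRate M (accessible M fail) (accessible M fail)

/-- The word `x` is rigid: `xⁿ` is accepted for all positive integers `n`. -/
def IsRigidWord (M : DFA α Q) (x : List α) : Prop :=
  ∀ n : ℕ, 0 < n → (List.replicate n x).flatten ∈ M.accepts

end Automata

/-! ### The hypotheses of the theorem -/

section Hypotheses

variable {C : Type u} [Category.{v} C] {S : Finset (Arrow C)} {Q : Type w}

/-- The word in the arrows of `C` underlying a word over the alphabet `S`. -/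
def toArrows (x : List S) : List (Arrow C) := x.map Subtype.val

/-- An element of a monoid of endomorphisms of `b`, regarded as an arrow from `b` to `b`. -/
def toHom {b : C} {G : Submonoid (End b)} (g : G) : b ⟶ b := g.1

/-- The automatic normal form hypothesis, for a monoid `G` of endomorphisms of one object of the
category, with normal forms `nf` over the finite set `S` of arrows: `nf g` represents `g`, and the
language of all normal forms is recognized by the automaton `M`, which is dominated by its
accessible sub-automaton and has a word `x` such that the paths of `x` and `x²` end in the same
accept state, which is accessible. (As a set of arrows, a submonoid of `End b` is the same thing
as a sub-category with the single object `b`.) -/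
structure AutomaticNormalForm {b : C} (G : Submonoid (End b)) (nf : G → List S)
    (M : DFA S Q) (fail : Q) : Prop where
  represents : ∀ g : G, IsProduct (toArrows (nf g)) (toHom g)
  fsa : IsFSA M fail
  recognized : ∀ x : List S, x ∈ M.accepts ↔ ∃ g : G, nf g = x
  dominated : IsDominated M fail
  exists_rigid : ∃ (x : List S) (E : Q), E ∈ M.accept ∧ E ∈ accessible M fail ∧
    M.eval x = E ∧ M.eval (x ++ x) = E

variable {X : Type*} [MetricSpace X]

/-- The geodesic words hypothesis: for some `R ≥ 0`, for every accepted word `x₁ x₂ ⋯ xₘ` and all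
`0 ≤ i < j ≤ m`, the points `x₁⋯xₖ.P` with `i ≤ k ≤ j` lie in the `R`-neighbourhood of every
geodesic connecting `x₁⋯xᵢ.P` and `x₁⋯xⱼ.P`. -/
def GeodesicWords (A : IsometricAction C X) (P : X) (M : DFA S Q) : Prop :=
  ∃ R : ℝ, 0 ≤ R ∧ ∀ x ∈ M.accepts, ∀ i j : ℕ, i < j → j ≤ x.length →
    ∀ σ : Set X,
      IsGeodesicSegment σ (A.actWord (toArrows (x.take i)) P)
        (A.actWord (toArrows (x.take j)) P) →
      ∀ k : ℕ, i ≤ k → k ≤ j → ∃ q ∈ σ, dist (A.actWord (toArrows (x.take k)) P) q ≤ R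

/-- There are interesting loxodromic actions: there is a loop in the accessible sub-automaton such
that the product of the letters read along this loop acts loxodromically. -/
def InterestingLoxodromic (A : IsometricAction C X) (P : X) (M : DFA S Q) (fail : Q) : Prop :=
  ∃ s ∈ accessible M fail, ∃ x : List S, (∀ y, y <+: x → M.evalFrom s y ∈ accessible M fail) ∧
    M.evalFrom s x = s ∧
    ∃ (a b : C) (f : a ⟶ b), IsProduct (toArrows x) f ∧ IsLoxodromic P (A.act f)

/-- `B(l)`: the elements of `G` whose normal form is of length at most `l`. -/
def normalFormBall {b : C} {G : Submonoid (End b)} (nf : G → List S) (l : ℕ) : Set G :=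
  {g | (nf g).length ≤ l}

end Hypotheses

end NormalForms

/-! One stretch of loxodromic motion, placed in a fixed prefix, makes a positive proportion of all
normal forms rigid and loxodromic.

Geometry: along accepted words the displacement of `P` is additive up to a constant
(`GeodesicWords.exists_dist_add_dist_le`). Let `E` be the accepting accessible state at which the
given rigid word ends. A prefix `u` leads both from the start and from `E` to `E`, and runs through
a high power of the loxodromic loop on its way. For every loop `v` at `E`, the word `u ++ v` is then
rigid and moves `P` far; the same estimate for its powers gives linear growth of the displacement
(`InterestingLoxodromic.exists_append_loop`).

Counting: let `a n` be the number of words readable in the accessible sub-automaton, and `b n` the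
number of words readable from the start outside it. A word avoiding the fail state is a `b`-word, or
a `b`-word followed by an entering letter and an `a`-word. Cutting makes `a` submultiplicative, and
recurrence makes it supermultiplicative up to a shift. By Fekete's argument the growth gap makes `∑
b n / a n` converge, so words avoiding the fail state number at most a constant times `a n`
(`IsDominated.exists_ncard_evalFrom_ne_fail_le`). Since `a`-words extend to loops at `E` at bounded
cost in length, the words `u ++ v` have positive proportion. -/

namespace NormalForms

/-! ### Exponential growth of submultiplicative sequences -/

/-- If a submultiplicative sequence `a` of positive integers grows exponentially faster than `b`,
then the quotients `b n / a n` are summable. -/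
theorem summable_div_of_expGrowthSup_lt {a b : ℕ → ℕ} (ha : ∀ n, 0 < a n)
    (hsub : ∀ m n, a (m + n) ≤ a m * a n)
    (h : ExpGrowth.expGrowthSup (fun n => (b n : ENNReal)) <
      ExpGrowth.expGrowthSup (fun n => (a n : ENNReal))) :
    Summable fun n => (b n : ℝ) / a n := by
  obtain ⟨x, hbx, hxa⟩ := EReal.lt_iff_exists_real_btwn.1 h
  obtain ⟨y, hxy, hya⟩ := EReal.lt_iff_exists_real_btwn.1 hxa
  have hxy : x < y := EReal.coe_lt_coe_iff.1 hxy
  have key : ∀ (z : ℝ) (n c : ℕ), EReal.exp ((z : EReal) * (n : EReal)) ≤ (c : ENNReal) ↔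
      Real.exp (z * n) ≤ c := by
    intro z n c
    have : (z : EReal) * (n : EReal) = ((z * n : ℝ) : EReal) := by push_cast; rfl
    rw [this, EReal.exp_coe, ← ENNReal.ofReal_natCast, ENNReal.ofReal_le_ofReal_iff (by positivity)]
  have key' : ∀ (z : ℝ) (n c : ℕ), (c : ENNReal) ≤ EReal.exp ((z : EReal) * (n : EReal)) ↔
      (c : ℝ) ≤ Real.exp (z * n) := by
    intro z n c
    have : (z : EReal) * (n : EReal) = ((z * n : ℝ) : EReal) := by push_cast; rfl
    rw [this, EReal.exp_coe, ← ENNReal.ofReal_natCast, ENNReal.ofReal_le_ofReal_iff (by positivity)]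
  have hb := ExpGrowth.eventually_le_exp hbx
  have ha' := ExpGrowth.frequently_exp_le hya
  simp only [key, key'] at hb ha'
  have hpos : ∀ n, (0 : ℝ) < a n := fun n => by exact_mod_cast ha n
  have hlog : Subadditive fun n => Real.log (a n) := by
    intro m n
    rw [← Real.log_mul (hpos m).ne' (hpos n).ne']
    exact Real.log_le_log (hpos _) (by exact_mod_cast hsub m n)
  -- Fekete: a single failure at `n` would, by subadditivity of `log a`, force `a m < exp (y * m)`
  -- for all large `m`, against `ha'`.
  have hlow : ∀ n : ℕ, n ≠ 0 → Real.exp (y * n) ≤ a n := by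
    intro n hn
    by_contra! hlt
    have hn' : (0 : ℝ) < n := by positivity
    have h1 : Real.log (a n) / n < y := by
      rw [div_lt_iff₀ hn']
      exact (Real.log_lt_iff_lt_exp (hpos n)).2 hlt
    obtain ⟨m, hm, hm', hm0⟩ := (ha'.and_eventually
      ((hlog.eventually_div_lt_of_div_lt hn h1).and (eventually_gt_atTop 0))).exists
    have hm0 : (0 : ℝ) < m := by exact_mod_cast hm0
    rw [div_lt_iff₀ hm0, Real.log_lt_iff_lt_exp (hpos m)] at hm'
    exact absurd hm hm'.not_ge
  have hgeom : Summable fun n : ℕ => Real.exp (x - y) ^ n :=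
    summable_geometric_of_lt_one (by positivity) (by simpa using hxy)
  refine Summable.of_norm_bounded_eventually_nat hgeom ?_
  filter_upwards [hb, eventually_ne_atTop (0 : ℕ)] with n hn hn0
  rw [Real.norm_of_nonneg (by positivity), ← Real.exp_nat_mul, div_le_iff₀ (hpos n)]
  calc (b n : ℝ) ≤ Real.exp (x * n) := hn
    _ = Real.exp (n * (x - y)) * Real.exp (y * n) := by rw [← Real.exp_add]; ring_nf
    _ ≤ _ := by gcongr; exact hlow n hn0

/-! ### Paths in the accessible sub-automaton -/

section Automata

variable {α : Type u} {Q : Type v} {M : DFA α Q} {fail : Q}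

theorem IsFSA.evalFrom_fail (h : IsFSA M fail) (x : List α) : M.evalFrom fail x = fail := by
  induction x with
  | nil => rfl
  | cons c x ih => rw [DFA.evalFrom_cons, h.step_fail, ih]

theorem IsFSA.evalFrom_ne_fail_of_prefix (h : IsFSA M fail) {s : Q} {x y : List α} (hyx : y <+: x)
    (hx : M.evalFrom s x ≠ fail) : M.evalFrom s y ≠ fail := by
  obtain ⟨z, rfl⟩ := hyx
  intro hy
  rw [DFA.evalFrom_of_append, hy, h.evalFrom_fail] at hx
  exact hx rfl

/-- Accessibility passes to successors, so a path can leave the accessible states only by failing.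
-/
theorem evalFrom_mem_accessible {s : Q} (hs : s ∈ accessible M fail)
    {x : List α} (hx : M.evalFrom s x ≠ fail) : M.evalFrom s x ∈ accessible M fail := by
  refine ⟨hx, fun t ht => ?_⟩
  obtain ⟨y, hy⟩ := hs.2 t ht
  exact ⟨y ++ x, by rw [DFA.evalFrom_of_append, hy]⟩

/-- Only the last state needs checking: failure is permanent, and a path from an accessible state
stays accessible until it fails. -/
theorem IsFSA.mem_readable_accessible (h : IsFSA M fail) {n : ℕ} {x : List α} :
    x ∈ readable M (accessible M fail) (accessible M fail) n ↔
      x.length = n ∧ ∃ s ∈ accessible M fail, M.evalFrom s x ∈ accessible M fail := by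
  refine and_congr_right fun _ => exists_congr fun s => and_congr_right fun hs => ?_
  exact ⟨fun H => H x List.prefix_rfl, fun H y hy =>
    evalFrom_mem_accessible hs (h.evalFrom_ne_fail_of_prefix hy H.1)⟩

/-- The words of length `n` which label a loop at the state `E`. -/
def loops (M : DFA α Q) (E : Q) (n : ℕ) : Set (List α) :=
  {x | x.length = n ∧ M.evalFrom E x = E}

/-- A word which avoids the fail state either never meets the accessible sub-automaton, or
starts in it, or enters it by some letter. -/
theorem IsFSA.eq_append_of_evalFrom_ne_fail (h : IsFSA M fail) {s : Q} {x : List α}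
    (hx : M.evalFrom s x ≠ fail) :
    (∀ y, y <+: x → M.evalFrom s y ∈ {s | s ≠ fail ∧ s ∉ accessible M fail}) ∨
      s ∈ accessible M fail ∨
      ∃ (y : List α) (c : α) (t : List α), x = y ++ c :: t ∧
        (∀ z, z <+: y → M.evalFrom s z ∈ {s | s ≠ fail ∧ s ∉ accessible M fail}) ∧
        M.evalFrom s (y ++ [c]) ∈ accessible M fail := by
  by_cases hs : s ∈ accessible M fail
  · exact Or.inr (Or.inl hs)
  have hs' : s ≠ fail := h.evalFrom_ne_fail_of_prefix List.nil_prefix hx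
  induction x generalizing s with
  | nil =>
    refine Or.inl fun y hy => ?_
    rw [List.prefix_nil.1 hy]
    exact ⟨hs', hs⟩
  | cons c x ih =>
    have hcx : M.evalFrom (M.step s c) x ≠ fail := hx
    by_cases hc : M.step s c ∈ accessible M fail
    · refine Or.inr (Or.inr ⟨[], c, x, rfl, fun z hz => ?_, hc⟩)
      rw [List.prefix_nil.1 hz]
      exact ⟨hs', hs⟩
    have hc' : M.step s c ≠ fail := h.evalFrom_ne_fail_of_prefix List.nil_prefix hcx
    have hcons : ∀ x : List α, (∀ z, z <+: x →
        M.evalFrom (M.step s c) z ∈ {s | s ≠ fail ∧ s ∉ accessible M fail}) →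
        ∀ z, z <+: c :: x → M.evalFrom s z ∈ {s | s ≠ fail ∧ s ∉ accessible M fail} := by
      intro x hx z hz
      rcases List.prefix_cons_iff.1 hz with rfl | ⟨z', rfl, hz'⟩
      · exact ⟨hs', hs⟩
      · exact hx z' hz'
    rcases ih hcx hc hc' with H | H | ⟨y, d, t, rfl, hy, hd⟩
    · exact Or.inl (hcons x H)
    · exact absurd H hc
    · exact Or.inr (Or.inr ⟨c :: y, d, t, rfl, hcons y hy, hd⟩)

/-- Recurrence would give a loop of positive length at the start state, whose last edge is
forbidden. -/
theorem start_notMem_accessible (h : IsFSA M fail) (hr : IsRecurrentOn M (accessible M fail)) :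
    M.start ∉ accessible M fail := by
  intro hs
  obtain ⟨l, hl, H⟩ := hr
  obtain ⟨x, hx, -, hx'⟩ := H _ hs _ hs
  rcases List.eq_nil_or_concat' x with rfl | ⟨y, c, rfl⟩
  · simp at hx; omega
  · rw [DFA.evalFrom_append_singleton] at hx'
    exact h.step_ne_start _ _ hx'

theorem IsFSA.readable_accessible_nonempty (h : IsFSA M fail) {l : ℕ} (hl0 : 0 < l)
    (hl : ∀ s ∈ accessible M fail, ∀ t ∈ accessible M fail, ∃ x : List α, x.length = l ∧
      M.evalFrom s x = t) (hT : (accessible M fail).Nonempty) (n : ℕ) :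
    (readable M (accessible M fail) (accessible M fail) n).Nonempty := by
  obtain ⟨E, hE⟩ := hT
  have step : ∀ s ∈ accessible M fail, ∃ c, M.step s c ∈ accessible M fail := by
    intro s hs
    obtain ⟨x, hx, hx'⟩ := hl s hs E hE
    cases x with
    | nil => simp at hx; omega
    | cons c x =>
      refine ⟨c, ?_⟩
      have := h.evalFrom_ne_fail_of_prefix (s := s) (y := [c]) (x := c :: x) (by simp)
        (by rw [hx']; exact hE.1)
      exact evalFrom_mem_accessible (x := [c]) hs this
  have : ∃ x : List α, x.length = n ∧ M.evalFrom E x ∈ accessible M fail := by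
    induction n with
    | zero => exact ⟨[], rfl, hE⟩
    | succ n ih =>
      obtain ⟨x, hx, hx'⟩ := ih
      obtain ⟨c, hc⟩ := step _ hx'
      exact ⟨x ++ [c], by simp [hx], by rwa [DFA.evalFrom_append_singleton]⟩
  obtain ⟨x, hx, hx'⟩ := this
  exact ⟨x, h.mem_readable_accessible.2 ⟨hx, E, hE, hx'⟩⟩

variable [Finite α]

theorem finite_setOf_length_eq_and (n : ℕ) (p : List α → Prop) :
    {x : List α | x.length = n ∧ p x}.Finite :=
  (List.finite_length_eq α n).subset fun _ h => h.1

theorem finite_readable (I T : Set Q) (n : ℕ) : (readable M I T n).Finite :=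
  finite_setOf_length_eq_and n _

theorem finite_loops (E : Q) (n : ℕ) : (loops M E n).Finite :=
  finite_setOf_length_eq_and n _

/-- Cut after `m` letters; the state reached there is accessible, so both pieces are readable. -/
theorem IsFSA.ncard_readable_add_le (h : IsFSA M fail) (m n : ℕ) :
    (readable M (accessible M fail) (accessible M fail) (m + n)).ncard ≤
      (readable M (accessible M fail) (accessible M fail) m).ncard *
        (readable M (accessible M fail) (accessible M fail) n).ncard := by
  rw [← Set.ncard_prod]
  refine Set.ncard_le_ncard_of_injOn (fun x => (x.take m, x.drop m)) ?_ ?_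
    ((finite_readable _ _ _).prod (finite_readable _ _ _))
  · rintro x hx
    rw [h.mem_readable_accessible] at hx
    obtain ⟨hlen, s, hs, hx⟩ := hx
    have hm := evalFrom_mem_accessible hs (h.evalFrom_ne_fail_of_prefix (List.take_prefix m x) hx.1)
    refine ⟨h.mem_readable_accessible.2 ⟨by simp [hlen], s, hs, hm⟩,
      h.mem_readable_accessible.2 ⟨by simp [hlen], _, hm, ?_⟩⟩
    rwa [← DFA.evalFrom_of_append, List.take_append_drop]
  · intro x _ y _ hxy
    simp only [Prod.mk.injEq] at hxy
    rw [← List.take_append_drop m x, hxy.1, hxy.2, List.take_append_drop]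

/-- Join the two words by a connecting path. As all connectors have length exactly `l`, both words
can be recovered from the result. -/
theorem IsFSA.ncard_readable_mul_le (h : IsFSA M fail) {l : ℕ}
    (hl : ∀ s ∈ accessible M fail, ∀ t ∈ accessible M fail, ∃ x : List α, x.length = l ∧
      M.evalFrom s x = t) (m n : ℕ) :
    (readable M (accessible M fail) (accessible M fail) m).ncard *
        (readable M (accessible M fail) (accessible M fail) n).ncard ≤
      (readable M (accessible M fail) (accessible M fail) (m + l + n)).ncard := by
  rw [← Set.ncard_prod]
  -- The connector is a total function of the pair, with dummy value `[]` on irrelevant pairs.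
  have H : ∀ p : List α × List α, ∃ c : List α,
      p ∈ readable M (accessible M fail) (accessible M fail) m ×ˢ
        readable M (accessible M fail) (accessible M fail) n →
      c.length = l ∧ p.1 ++ c ++ p.2 ∈
        readable M (accessible M fail) (accessible M fail) (m + l + n) := by
    rintro ⟨x, y⟩
    by_cases hp : (x, y) ∈ readable M (accessible M fail) (accessible M fail) m ×ˢ
        readable M (accessible M fail) (accessible M fail) n
    · obtain ⟨hx, hy⟩ := hp
      simp only [h.mem_readable_accessible] at hx hy
      obtain ⟨hxl, s, hs, hx⟩ := hx
      obtain ⟨hyl, t, ht, hy⟩ := hy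
      obtain ⟨c, hcl, hc⟩ := hl _ hx _ ht
      refine ⟨c, fun _ => ⟨hcl, h.mem_readable_accessible.2 ⟨by simp [hxl, hyl, hcl, add_assoc], s, hs, ?_⟩⟩⟩
      rwa [DFA.evalFrom_of_append, DFA.evalFrom_of_append, hc]
    · exact ⟨[], fun h => absurd h hp⟩
  choose c hc using H
  refine Set.ncard_le_ncard_of_injOn (fun p => p.1 ++ c p ++ p.2) (fun p hp => (hc p hp).2) ?_
    (finite_readable _ _ _)
  rintro ⟨x, y⟩ hp ⟨x', y'⟩ hp' heq
  simp only [List.append_assoc] at heq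
  obtain ⟨h1, h2⟩ := List.append_inj heq (hp.1.1.trans hp'.1.1.symm)
  have h3 := (List.append_inj h2 ((hc _ hp).1.trans (hc _ hp').1.symm)).2
  exact Prod.ext h1 h3

/-- Connectors of length `l` on both sides, from `E` and back to `E`, close a readable word to a
loop. -/
theorem IsFSA.ncard_readable_le_ncard_loops (h : IsFSA M fail) {l : ℕ}
    (hl : ∀ s ∈ accessible M fail, ∀ t ∈ accessible M fail, ∃ x : List α, x.length = l ∧
      M.evalFrom s x = t) {E : Q} (hE : E ∈ accessible M fail) (n : ℕ) :
    (readable M (accessible M fail) (accessible M fail) n).ncard ≤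
      (loops M E (l + n + l)).ncard := by
  have H : ∀ x : List α, ∃ c : List α × List α,
      x ∈ readable M (accessible M fail) (accessible M fail) n →
      c.1.length = l ∧ c.1 ++ x ++ c.2 ∈ loops M E (l + n + l) := by
    intro x
    by_cases hx : x ∈ readable M (accessible M fail) (accessible M fail) n
    · have hx' := hx
      rw [h.mem_readable_accessible] at hx'
      obtain ⟨hxl, s, hs, hx'⟩ := hx'
      obtain ⟨c, hcl, hc⟩ := hl _ hE _ hs
      obtain ⟨d, hdl, hd⟩ := hl _ hx' _ hE
      refine ⟨(c, d), fun _ => ⟨hcl, by simp [hcl, hdl, hxl]; omega, ?_⟩⟩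
      rw [DFA.evalFrom_of_append, DFA.evalFrom_of_append, hc, hd]
    · exact ⟨([], []), fun h => absurd h hx⟩
  choose c hc using H
  refine Set.ncard_le_ncard_of_injOn (fun x => (c x).1 ++ x ++ (c x).2) (fun x hx => (hc x hx).2) ?_
    (finite_loops _ _)
  intro x hx y hy heq
  simp only [List.append_assoc] at heq
  have h2 := (List.append_inj heq ((hc x hx).1.trans (hc y hy).1.symm)).2
  exact (List.append_inj h2 (hx.1.trans hy.1.symm)).1

/-- Sort words by the length `i` of the part before the accessible states are entered. The entering
letter accounts for the factor `Nat.card α` and for the `- 1` in `n - 1 - i`. -/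
theorem IsFSA.ncard_evalFrom_ne_fail_le (h : IsFSA M fail) (hs : M.start ∉ accessible M fail)
    (n : ℕ) :
    {x : List α | x.length = n ∧ M.eval x ≠ fail}.ncard ≤
      (readable M {M.start} {s | s ≠ fail ∧ s ∉ accessible M fail} n).ncard +
      ∑ i ∈ Finset.range n,
        (readable M {M.start} {s | s ≠ fail ∧ s ∉ accessible M fail} i).ncard *
          (Nat.card α * (readable M (accessible M fail) (accessible M fail) (n - 1 - i)).ncard) := by
  set b := readable M {M.start} {s | s ≠ fail ∧ s ∉ accessible M fail} with hb
  set a := readable M (accessible M fail) (accessible M fail) with ha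
  have hfin : ∀ i, (b i ×ˢ (Set.univ : Set α) ×ˢ a (n - 1 - i)).Finite := fun i =>
    (finite_readable _ _ _).prod (Set.finite_univ.prod (finite_readable _ _ _))
  let f : List α × α × List α → List α := fun p => p.1 ++ p.2.1 :: p.2.2
  have hsub : {x : List α | x.length = n ∧ M.eval x ≠ fail} ⊆
      b n ∪ ⋃ i ∈ Finset.range n, f '' (b i ×ˢ (Set.univ : Set α) ×ˢ a (n - 1 - i)) := by
    rintro x ⟨hxn, hx⟩
    rcases h.eq_append_of_evalFrom_ne_fail hx with H | H | ⟨y, c, t, rfl, hy, hc⟩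
    · exact Or.inl ⟨hxn, _, rfl, H⟩
    · exact absurd H hs
    · simp at hxn
      refine Or.inr (Set.mem_biUnion (x := y.length) (by simp; omega)
        ⟨(y, c, t), ⟨⟨rfl, _, rfl, hy⟩, Set.mem_univ _,
          h.mem_readable_accessible.2 ⟨by simp; omega, _, hc, ?_⟩⟩, rfl⟩)
      refine evalFrom_mem_accessible hc ?_
      rwa [← DFA.evalFrom_of_append, List.append_assoc]
  refine (Set.ncard_le_ncard hsub ?_).trans ((Set.ncard_union_le _ _).trans ?_)
  · exact (finite_readable _ _ _).union
      (Set.Finite.biUnion (Finset.finite_toSet _) fun i _ => (hfin i).image f)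
  · gcongr
    refine (Finset.set_ncard_biUnion_le _ _).trans (Finset.sum_le_sum fun i _ => ?_)
    refine (Set.ncard_image_le (hfin i)).trans ?_
    rw [Set.ncard_prod, Set.ncard_prod, Set.ncard_univ]

end Automata

/-! ### Counting accepted words -/

section Counting

variable {α : Type u} {Q : Type v} {M : DFA α Q} {fail : Q} [Finite α]

/-- The number of words of length `n` which avoid the fail state is bounded by a constant multiple
of the number of words of length `n` which can be read in the accessible sub-automaton. -/
theorem IsDominated.exists_ncard_evalFrom_ne_fail_le (hD : IsDominated M fail)
    (h : IsFSA M fail) :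
    ∃ C : ℝ, 0 ≤ C ∧ ∀ n, ({x : List α | x.length = n ∧ M.eval x ≠ fail}.ncard : ℝ) ≤
      C * (readable M (accessible M fail) (accessible M fail) n).ncard := by
  have hs := start_notMem_accessible h hD.recurrent
  obtain ⟨l, hl0, hl⟩ := hD.recurrent
  replace hl : ∀ s ∈ accessible M fail, ∀ t ∈ accessible M fail, ∃ x : List α, x.length = l ∧
      M.evalFrom s x = t := fun s hs t ht =>
    let ⟨x, hx, _, hx'⟩ := hl s hs t ht
    ⟨x, hx, hx'⟩
  have hcount := h.ncard_evalFrom_ne_fail_le hs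
  have hsub := h.ncard_readable_add_le
  have hsup := h.ncard_readable_mul_le hl
  have hgrowth := hD.growth
  have hpos : ∀ n, 0 < (readable M (accessible M fail) (accessible M fail) n).ncard := fun n =>
    (Set.ncard_pos (finite_readable _ _ _)).2
      (h.readable_accessible_nonempty hl0 hl hD.nonempty n)
  simp only [growthRate, ← (finite_readable _ _ _).cast_ncard_eq, ENat.toENNReal_coe] at hgrowth
  generalize (readable M (accessible M fail) (accessible M fail)) = a at *
  generalize (readable M {M.start} {s | s ≠ fail ∧ s ∉ accessible M fail}) = b at *
  have hsum := summable_div_of_expGrowthSup_lt hpos hsub hgrowth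
  have hpos' : ∀ n, (0 : ℝ) < (a n).ncard := fun n => by exact_mod_cast hpos n
  set d : ℕ → ℝ := fun n => ((b n).ncard : ℝ) / (a n).ncard with hd
  have hd0 : ∀ n, 0 ≤ d n := fun n => by positivity
  have hb : ∀ n, ((b n).ncard : ℝ) = d n * (a n).ncard := fun n =>
    (div_mul_cancel₀ _ (hpos' n).ne').symm
  have hS : 0 ≤ ∑' n, d n := tsum_nonneg hd0
  -- The `1` bounds the words that never enter the accessible states, the other summand those that
  -- do.
  refine ⟨(∑' n, d n) * (1 + Nat.card α * (a (l - 1)).ncard), by positivity, fun n => ?_⟩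
  have hterm : ∀ i ∈ Finset.range n, ((b i).ncard : ℝ) * (Nat.card α * (a (n - 1 - i)).ncard) ≤
      d i * (Nat.card α * ((a (l - 1)).ncard * (a n).ncard)) := by
    intro i hi
    rw [Finset.mem_range] at hi
    -- Joining gives total length `(l - 1) + n`; cutting off `l - 1` letters then returns to length
    -- `n`.
    have h1 : (a i).ncard * (a (n - 1 - i)).ncard ≤ (a (l - 1)).ncard * (a n).ncard := by
      refine (hsup _ _).trans ?_
      rw [show i + l + (n - 1 - i) = (l - 1) + n by omega]
      exact hsub _ _
    have h2 : ((a i).ncard : ℝ) * (a (n - 1 - i)).ncard ≤ (a (l - 1)).ncard * (a n).ncard := by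
      exact_mod_cast h1
    calc ((b i).ncard : ℝ) * (Nat.card α * (a (n - 1 - i)).ncard)
        = d i * (Nat.card α * ((a i).ncard * (a (n - 1 - i)).ncard)) := by rw [hb]; ring
      _ ≤ _ := mul_le_mul_of_nonneg_left (by gcongr) (hd0 i)
  calc ({x : List α | x.length = n ∧ M.eval x ≠ fail}.ncard : ℝ)
      ≤ (b n).ncard + ∑ i ∈ Finset.range n,
          ((b i).ncard : ℝ) * (Nat.card α * (a (n - 1 - i)).ncard) := by
        exact_mod_cast hcount n
    _ ≤ (∑' n, d n) * (a n).ncard +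
          (∑' n, d n) * (Nat.card α * ((a (l - 1)).ncard * (a n).ncard)) := by
        refine add_le_add ?_ ((Finset.sum_le_sum hterm).trans ?_)
        · rw [hb]
          gcongr
          exact hsum.le_tsum n fun i _ => hd0 i
        · rw [← Finset.sum_mul]
          gcongr
          exact hsum.sum_le_tsum _ fun i _ => hd0 i
    _ = _ := by ring

/-- For a dominated automaton, loops at an accessible state make up a positive proportion of the
words avoiding the fail state, even after shifting the length by a constant `k`. -/
theorem IsDominated.exists_ncard_le_ncard_loops (hD : IsDominated M fail) (h : IsFSA M fail)
    {E : Q} (hE : E ∈ accessible M fail) (k : ℕ) :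
    ∃ (C : ℝ) (K : ℕ), 0 ≤ C ∧ k ≤ K ∧ ∀ n, K ≤ n → 0 < (loops M E (n - k)).ncard ∧
      ({x : List α | x.length = n ∧ M.eval x ≠ fail}.ncard : ℝ) ≤
        C * (loops M E (n - k)).ncard := by
  obtain ⟨C, hC, hle⟩ := hD.exists_ncard_evalFrom_ne_fail_le h
  obtain ⟨l, hl0, hl⟩ := hD.recurrent
  replace hl : ∀ s ∈ accessible M fail, ∀ t ∈ accessible M fail, ∃ x : List α, x.length = l ∧
      M.evalFrom s x = t := fun s hs t ht =>
    let ⟨x, hx, _, hx'⟩ := hl s hs t ht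
    ⟨x, hx, hx'⟩
  set a := readable M (accessible M fail) (accessible M fail)
  -- For `n = k + 2 * l + m`, cutting bounds `a n` by `a (k + 2 * l) * a m`, and words counted by `a
  -- m` extend to loops of length `m + 2 * l = n - k`.
  refine ⟨C * (a (k + 2 * l)).ncard, k + 2 * l, by positivity, by omega, fun n hn => ?_⟩
  obtain ⟨m, rfl⟩ := Nat.exists_eq_add_of_le hn
  have hloop := h.ncard_readable_le_ncard_loops hl hE m
  rw [show l + m + l = k + 2 * l + m - k by omega] at hloop
  have hpos : 0 < (a m).ncard := (Set.ncard_pos (finite_readable _ _ _)).2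
    (h.readable_accessible_nonempty hl0 hl hD.nonempty m)
  refine ⟨hpos.trans_le hloop, (hle _).trans ?_⟩
  rw [mul_assoc]
  gcongr
  exact_mod_cast (h.ncard_readable_add_le _ _).trans (Nat.mul_le_mul_left _ hloop)

theorem ncard_setOf_length_le (X : Set (List α)) (l : ℕ) :
    {x ∈ X | x.length ≤ l}.ncard = ∑ n ∈ Finset.range (l + 1), {x ∈ X | x.length = n}.ncard := by
  induction l with
  | zero => simp
  | succ l ih =>
    rw [Finset.sum_range_succ, ← ih, ← Set.ncard_union_eq ?_
      ((List.finite_length_le α l).subset fun x hx => hx.2)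
      ((List.finite_length_eq α (l + 1)).subset fun x hx => hx.2)]
    · congr 1
      ext x
      simp only [Set.mem_ofPred_eq, Set.mem_union, ← and_or_left]
      refine and_congr_right fun _ => ?_
      omega
    · rw [Set.disjoint_left]
      rintro x ⟨_, h1⟩ ⟨_, h2⟩
      omega

/-- If all but finitely many spheres of a set `Y` of words contain a positive proportion of the
sphere of a set `X`, then so do the balls. -/
theorem exists_ncard_setOf_length_le_le (X Y : Set (List α)) (C : ℝ) (hC : 0 ≤ C) (K : ℕ)
    (hK : ∀ n, K ≤ n → 0 < {x ∈ Y | x.length = n}.ncard ∧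
      ({x ∈ X | x.length = n}.ncard : ℝ) ≤ C * {x ∈ Y | x.length = n}.ncard) :
    ∃ B : ℝ, 0 < B ∧ ∀ l, K ≤ l →
      ({x ∈ X | x.length ≤ l}.ncard : ℝ) ≤ B * {x ∈ Y | x.length ≤ l}.ncard := by
  simp only [ncard_setOf_length_le, Nat.cast_sum]
  -- The first `K` spheres contribute a constant, absorbed because the ball of `Y` has at least one
  -- element; the `1` keeps the bound positive.
  refine ⟨∑ n ∈ Finset.range K, ({x ∈ X | x.length = n}.ncard : ℝ) + C + 1, by positivity,
    fun l hl => ?_⟩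
  set s : ℝ := ∑ n ∈ Finset.range (l + 1), ({x ∈ Y | x.length = n}.ncard : ℝ) with hs
  have h1 : 1 ≤ s := by
    have : (1 : ℝ) ≤ {x ∈ Y | x.length = l}.ncard := by exact_mod_cast (hK l hl).1
    exact this.trans (Finset.single_le_sum
      (f := fun n => ({x ∈ Y | x.length = n}.ncard : ℝ)) (fun _ _ => by positivity) (by simp))
  have h2 : ∑ n ∈ Finset.Ico K (l + 1), ({x ∈ X | x.length = n}.ncard : ℝ) ≤ C * s := by
    refine (Finset.sum_le_sum fun n hn => (hK n (Finset.mem_Ico.1 hn).1).2).trans ?_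
    rw [← Finset.mul_sum]
    refine mul_le_mul_of_nonneg_left (Finset.sum_le_sum_of_subset_of_nonneg (fun n hn => ?_)
      fun _ _ _ => by positivity) hC
    exact Finset.mem_range.2 (Finset.mem_Ico.1 hn).2
  rw [← Finset.sum_range_add_sum_Ico _ (show K ≤ l + 1 by omega)]
  have h3 : 0 ≤ ∑ n ∈ Finset.range K, ({x ∈ X | x.length = n}.ncard : ℝ) := by positivity
  nlinarith

end Counting

/-! ### Loxodromic actions of rigid words -/

section Words

variable {C : Type u} [Category.{v} C]

/-- A word has at most one product with a given source. -/
theorem IsProduct.mk_eq_mk {x : List (Arrow C)} {a b : C} {f : a ⟶ b} (hf : IsProduct x f) :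
    ∀ {d : C} {g : a ⟶ d}, IsProduct x g → Arrow.mk f = Arrow.mk g := by
  induction hf with
  | nil a =>
    intro d g hg
    cases hg
    rfl
  | cons f₁ f₂ x _ ih =>
    intro d g hg
    cases hg with
    | cons _ g₂ _ hg₂ =>
      have := ih hg₂
      cases this
      rfl

theorem IsProduct.unique {x : List (Arrow C)} {a b : C} {f g : a ⟶ b} (hf : IsProduct x f)
    (hg : IsProduct x g) : f = g := by
  have h := hf.mk_eq_mk hg
  cases h
  rfl

namespace IsometricAction

variable {X : Type w} [MetricSpace X] (A : IsometricAction C X)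

theorem actWord_append (x y : List (Arrow C)) (p : X) :
    A.actWord (x ++ y) p = A.actWord x (A.actWord y p) := by
  induction x with
  | nil => rfl
  | cons f x ih => exact congrArg (A.act f.hom) ih

theorem isometry_actWord (x : List (Arrow C)) : Isometry (A.actWord x) := by
  induction x with
  | nil => exact fun _ _ => rfl
  | cons f x ih => exact (A.isometry f.hom).comp ih

variable {S : Finset (Arrow C)}

theorem actWord_toArrows_append (x y : List S) (p : X) :
    A.actWord (toArrows (x ++ y)) p = A.actWord (toArrows x) (A.actWord (toArrows y) p) := by
  rw [toArrows, List.map_append, actWord_append]; rfl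

theorem actWord_flatten_replicate (x : List S) (n : ℕ) (p : X) :
    A.actWord (toArrows (List.replicate n x).flatten) p = (A.actWord (toArrows x))^[n] p := by
  induction n with
  | zero => rfl
  | succ n ih =>
    rw [List.replicate_succ, List.flatten_cons, actWord_toArrows_append, ih,
      Function.iterate_succ_apply']

theorem dist_actWord_append_le (P : X) (x y : List S) :
    dist P (A.actWord (toArrows (x ++ y)) P) ≤
      dist P (A.actWord (toArrows x) P) + dist P (A.actWord (toArrows y) P) := by
  rw [actWord_toArrows_append, ← (A.isometry_actWord (toArrows x)).dist_eq P (A.actWord (toArrows y) P)]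
  exact dist_triangle _ _ _

end IsometricAction

variable {X : Type w} [MetricSpace X] {A : IsometricAction C X} {S : Finset (Arrow C)}
  {Q : Type*} {M : DFA S Q} {P : X}

/-- Along accepted words, the displacement of the base point is additive up to a constant. -/
theorem GeodesicWords.exists_dist_add_dist_le (hR : GeodesicWords A P M)
    (hX : ∀ x y : X, ∃ σ : Set X, IsGeodesicSegment σ x y) :
    ∃ R : ℝ, 0 ≤ R ∧ ∀ x y z : List S, x ++ y ++ z ∈ M.accepts →
      dist P (A.actWord (toArrows x) P) + dist P (A.actWord (toArrows y) P) ≤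
        dist P (A.actWord (toArrows (x ++ y)) P) + R := by
  obtain ⟨R, hR0, hR⟩ := hR
  -- The point `x.P` is `R`-close to a point of the geodesic from `P` to `xy.P`; each of the two
  -- triangle inequalities costs `R`.
  refine ⟨2 * R, by positivity, fun x y z h => ?_⟩
  -- The geodesic words hypothesis requires `i < j`, so the empty word is treated apart.
  rcases Nat.eq_zero_or_pos (x ++ y).length with h0 | h0
  · simp only [List.length_eq_zero_iff, List.append_eq_nil_iff] at h0
    obtain ⟨rfl, rfl⟩ := h0
    simp [toArrows, IsometricAction.actWord, hR0]
  obtain ⟨σ, hσ⟩ := hX P (A.actWord (toArrows (x ++ y)) P)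
  obtain ⟨q, hq, hxq⟩ := hR _ h 0 (x ++ y).length h0 (by simp) σ
    (by rwa [List.take_left, List.take_zero]) x.length (Nat.zero_le _) (by simp)
  rw [List.append_assoc, List.take_left] at hxq
  obtain ⟨γ, h0, h1, hγ, rfl⟩ := hσ
  obtain ⟨s, hs, rfl⟩ := hq
  have e1 := hγ 0 ⟨le_rfl, hs.1.trans hs.2⟩ s hs
  have e2 := hγ s hs _ ⟨hs.1.trans hs.2, le_rfl⟩
  rw [h0, zero_sub, abs_neg, abs_of_nonneg hs.1] at e1
  rw [h1, abs_sub_comm, abs_of_nonneg (sub_nonneg.2 hs.2)] at e2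
  have e3 : dist P (A.actWord (toArrows y) P) =
      dist (A.actWord (toArrows x) P) (A.actWord (toArrows (x ++ y)) P) := by
    rw [A.actWord_toArrows_append, (A.isometry_actWord (toArrows x)).dist_eq]
  have t1 := dist_triangle_right P (A.actWord (toArrows x) P) (γ s)
  have t2 := dist_triangle (A.actWord (toArrows x) P) (γ s) (A.actWord (toArrows (x ++ y)) P)
  rw [e3]
  linarith

/-- A rigid word which moves the base point far enough acts loxodromically. -/
theorem IsRigidWord.isLoxodromic {x : List S} (hx : IsRigidWord M x) {R : ℝ}
    (hR : ∀ x y z : List S, x ++ y ++ z ∈ M.accepts →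
      dist P (A.actWord (toArrows x) P) + dist P (A.actWord (toArrows y) P) ≤
        dist P (A.actWord (toArrows (x ++ y)) P) + R)
    (hd : R < dist P (A.actWord (toArrows x) P)) :
    IsLoxodromic P (A.actWord (toArrows x)) := by
  set D : ℕ → ℝ := fun n => dist P ((A.actWord (toArrows x))^[n] P) with hD
  -- Subadditivity makes `D n / n` converge; `hlow` keeps the limit positive.
  have hsub : Subadditive D := by
    intro m n
    simp only [hD, ← A.actWord_flatten_replicate, List.replicate_add, List.flatten_append]
    exact A.dist_actWord_append_le P _ _
  have hlow : ∀ n : ℕ, n * (dist P (A.actWord (toArrows x) P) - R) ≤ D n := by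
    intro n
    induction n with
    | zero => simp [hD]
    | succ n ih =>
      have h := hR (List.replicate n x).flatten x [] (by
        have := hx (n + 1) n.succ_pos
        simpa [List.replicate_succ'] using this)
      rw [A.actWord_flatten_replicate, A.actWord_toArrows_append, A.actWord_flatten_replicate,
        ← Function.iterate_succ_apply (A.actWord (toArrows x))] at h
      push_cast
      simp only [hD] at ih ⊢
      linarith
  have hbdd : BddBelow (Set.range fun n : ℕ => D n / n) :=
    ⟨0, by rintro _ ⟨n, rfl⟩; positivity⟩
  refine ⟨hsub.lim, (sub_pos.2 hd).trans_le (ge_of_tendsto (hsub.tendsto_lim hbdd) ?_),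
    hsub.tendsto_lim hbdd⟩
  filter_upwards [eventually_gt_atTop 0] with n hn
  rw [le_div_iff₀ (by exact_mod_cast hn), mul_comm]
  exact hlow n

theorem IsLoxodromic.exists_lt_dist {φ : X → X} (h : IsLoxodromic P φ) (B : ℝ) :
    ∃ n : ℕ, B < dist P (φ^[n] P) := by
  obtain ⟨τ, hτ, h⟩ := h
  have h2 : Tendsto (fun n : ℕ => dist P (φ^[n] P)) atTop atTop := by
    refine (h.pos_mul_atTop hτ tendsto_natCast_atTop_atTop).congr' ?_
    filter_upwards [eventually_ne_atTop 0] with n hn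
    exact div_mul_cancel₀ _ (by exact_mod_cast hn)
  exact (h2.eventually_gt_atTop B).exists

end Words

/-! ### Rigid words through a loxodromic loop -/

theorem evalFrom_flatten_replicate {α : Type u} {Q : Type v} {M : DFA α Q} {s : Q} {x : List α}
    (h : M.evalFrom s x = s) (n : ℕ) : M.evalFrom s (List.replicate n x).flatten = s := by
  induction n with
  | zero => rfl
  | succ n ih => rw [List.replicate_succ, List.flatten_cons, DFA.evalFrom_of_append, h, ih]

/-- The first copy of `x` reaches `E`, and every further copy loops there. -/
theorem isRigidWord_of_eval {α : Type u} {Q : Type v} {M : DFA α Q} {E : Q} {x : List α}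
    (hE : E ∈ M.accept) (h₁ : M.eval x = E) (h₂ : M.evalFrom E x = E) : IsRigidWord M x := by
  intro n hn
  obtain ⟨m, rfl⟩ := Nat.exists_eq_succ_of_ne_zero hn.ne'
  rw [DFA.mem_accepts, List.replicate_succ, List.flatten_cons, DFA.eval, DFA.evalFrom_of_append]
  change M.evalFrom (M.eval x) _ ∈ _
  rwa [h₁, evalFrom_flatten_replicate h₂]


section Main

variable {C : Type u} [Category.{v} C] {X : Type w} [MetricSpace X] {A : IsometricAction C X}
  {S : Finset (Arrow C)} {Q : Type*} {M : DFA S Q} {fail : Q} {P : X}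

/-- There is a word `u` from the start state to a given accepting accessible state `E` such that
all words `u ++ v`, for `v` a loop at `E`, are rigid and act loxodromically. -/
theorem InterestingLoxodromic.exists_append_loop (hL : InterestingLoxodromic A P M fail)
    (hR : GeodesicWords A P M) (hX : ∀ x y : X, ∃ σ : Set X, IsGeodesicSegment σ x y)
    {E : Q} (hE : E ∈ M.accept) (hE' : E ∈ accessible M fail) {r : List S} (hr : M.eval r = E)
    (hrr : M.eval (r ++ r) = E) :
    ∃ u : List S, ∀ v : List S, M.evalFrom E v = E → u ++ v ∈ M.accepts ∧
      IsRigidWord M (u ++ v) ∧ IsLoxodromic P (A.actWord (toArrows (u ++ v))) := by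
  obtain ⟨s, hs, x, -, hx, a, b, f, hf, hlox⟩ := hL
  obtain ⟨R, hR0, hR⟩ := hR.exists_dist_add_dist_le hX
  have hφ : A.act f = A.actWord (toArrows x) := funext fun p => A.act_eq_actWord hf p
  rw [hφ] at hlox
  -- Splitting off what precedes and what follows the loop costs `R` each; a displacement above `R`
  -- must remain for `IsRigidWord.isLoxodromic`.
  obtain ⟨N, hN⟩ := hlox.exists_lt_dist (3 * R)
  rw [← A.actWord_flatten_replicate] at hN
  have hxN := evalFrom_flatten_replicate hx N
  set z := (List.replicate N x).flatten
  -- A detour from `E` to the loxodromic loop at `s` and back.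
  obtain ⟨y, hy⟩ := hs.2 E hE'.1
  obtain ⟨y', hy'⟩ := hE'.2 s hs.1
  have hr' : M.evalFrom E r = E := by
    rwa [DFA.eval, DFA.evalFrom_of_append, ← DFA.eval, hr] at hrr
  refine ⟨r ++ y ++ z ++ y', fun v hv => ?_⟩
  have h₁ : M.eval (r ++ y ++ z ++ y' ++ v) = E := by
    simp only [DFA.eval, DFA.evalFrom_of_append]
    rw [← DFA.eval, hr, hy, hxN, hy', hv]
  have h₂ : M.evalFrom E (r ++ y ++ z ++ y' ++ v) = E := by
    simp only [DFA.evalFrom_of_append]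
    rw [hr', hy, hxN, hy', hv]
  have hacc : r ++ y ++ z ++ y' ++ v ∈ M.accepts := by
    rw [DFA.mem_accepts, h₁]
    exact hE
  have hrigid := isRigidWord_of_eval hE h₁ h₂
  refine ⟨hacc, hrigid, hrigid.isLoxodromic hR ?_⟩
  have e₁ := hR (r ++ y) z (y' ++ v) (by simpa only [List.append_assoc] using hacc)
  have e₂ := hR (r ++ y ++ z) (y' ++ v) [] (by simpa using hacc)
  rw [← List.append_assoc] at e₂
  have e₃ := @dist_nonneg _ _ P (A.actWord (toArrows (r ++ y)) P)
  have e₄ := @dist_nonneg _ _ P (A.actWord (toArrows (y' ++ v)) P)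
  linarith

/-- A word with fixed source has only one product. Counting elements thus becomes counting accepted
words. -/
theorem AutomaticNormalForm.injective {b : C} {G : Submonoid (End b)} {nf : G → List S}
    (hG : AutomaticNormalForm G nf M fail) : Function.Injective nf := by
  intro g g' h
  have h' := hG.represents g'
  rw [← h] at h'
  exact Subtype.ext ((hG.represents g).unique h')

end Main

end NormalForms

/-! ### Positive lower density -/

open NormalForms

/-- Rigid elements which act loxodromically have positive lower density in the balls `B(l)`. -/
theorem theorem2 {C : Type*} [Category C] {b : C} (G : Submonoid (End b))
    (S : Finset (Arrow C)) (nf : G → List S)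
    {Q : Type*} [Finite Q] (M : DFA S Q) (fail : Q)
    {X : Type*} [MetricSpace X] (δ : ℝ) (hX : NormalForms.IsHyperbolicGeodesicSpace X δ) (P : X)
    (A : NormalForms.IsometricAction C X)
    (hG : NormalForms.AutomaticNormalForm G nf M fail)
    (hR : NormalForms.GeodesicWords A P M)
    (hL : NormalForms.InterestingLoxodromic A P M fail) :
    0 < liminf (fun l : ℕ =>
      (({g ∈ NormalForms.normalFormBall nf l | NormalForms.IsRigidWord M (nf g) ∧
          NormalForms.IsLoxodromic P (A.act (NormalForms.toHom g))}.ncard : ℝ) /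
        ((NormalForms.normalFormBall nf l).ncard : ℝ))) atTop := by
  obtain ⟨r, E, hE, hE', hr, hrr⟩ := hG.exists_rigid
  obtain ⟨u, hu⟩ := hL.exists_append_loop hR hX.1 hE hE' hr hrr
  set Y : Set (List S) := {x | x ∈ M.accepts ∧ IsRigidWord M x ∧
    IsLoxodromic P (A.actWord (toArrows x))} with hY
  obtain ⟨c, K, hc, huK, hK⟩ :=
    hG.dominated.exists_ncard_le_ncard_loops hG.fsa hE' u.length
  -- Prefixing by `u` is injective, and `u.length ≤ K ≤ n` makes the subtraction exact.
  have hloop : ∀ n, K ≤ n → (loops M E (n - u.length)).ncard ≤ {x ∈ Y | x.length = n}.ncard := by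
    intro n hn
    refine Set.ncard_le_ncard_of_injOn (u ++ ·) (fun v hv => ⟨hu v hv.2, ?_⟩)
      (fun v _ v' _ h => List.append_cancel_left h) 
      ((List.finite_length_eq S n).subset fun x hx => hx.2)
    have := hv.1
    rw [List.length_append]
    omega
  have hacc : ∀ n, {x ∈ M.accepts | x.length = n} ⊆ {x | x.length = n ∧ M.eval x ≠ fail} := by
    rintro n x ⟨hx, hn⟩
    refine ⟨hn, fun h => hG.fsa.fail_notMem_accept ?_⟩
    rw [← h]
    exact hx
  obtain ⟨B, hB, hball⟩ := exists_ncard_setOf_length_le_le M.accepts Y c hc K fun n hn =>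
    ⟨(hK n hn).1.trans_le (hloop n hn), by
      calc ({x ∈ M.accepts | x.length = n}.ncard : ℝ)
          ≤ ({x : List S | x.length = n ∧ M.eval x ≠ fail}.ncard : ℝ) := by
            exact_mod_cast Set.ncard_le_ncard (hacc n) (finite_setOf_length_eq_and n _)
        _ ≤ _ := (hK n hn).2
        _ ≤ _ := mul_le_mul_of_nonneg_left (by exact_mod_cast hloop n hn) hc⟩
  have hact : ∀ g : G, A.act (toHom g) = A.actWord (toArrows (nf g)) := fun g =>
    funext fun p => A.act_eq_actWord (hG.represents g) p
  have hnf : ∀ g, nf g ∈ M.accepts := fun g => (hG.recognized _).2 ⟨g, rfl⟩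
  have hX' : ∀ l, (normalFormBall nf l).ncard = {x ∈ M.accepts | x.length ≤ l}.ncard := by
    intro l
    rw [← Set.ncard_image_of_injective _ hG.injective]
    congr 1
    ext x
    constructor
    · rintro ⟨g, hg, rfl⟩
      exact ⟨hnf g, hg⟩
    · rintro ⟨hx, hl⟩
      obtain ⟨g, rfl⟩ := (hG.recognized x).1 hx
      exact ⟨g, hl, rfl⟩
  have hY' : ∀ l, {g ∈ normalFormBall nf l | IsRigidWord M (nf g) ∧
      IsLoxodromic P (A.act (toHom g))}.ncard = {x ∈ Y | x.length ≤ l}.ncard := by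
    intro l
    rw [← Set.ncard_image_of_injective _ hG.injective]
    congr 1
    ext x
    constructor
    · rintro ⟨g, ⟨hg, hrig, hlox⟩, rfl⟩
      rw [hact] at hlox
      exact ⟨⟨hnf g, hrig, hlox⟩, hg⟩
    · rintro ⟨⟨hx, hrig, hlox⟩, hl⟩
      obtain ⟨g, rfl⟩ := (hG.recognized x).1 hx
      rw [← hact] at hlox
      exact ⟨g, ⟨hl, hrig, hlox⟩, rfl⟩
  simp only [hX', hY']
  have hle : ∀ l, {x ∈ Y | x.length ≤ l}.ncard ≤ {x ∈ M.accepts | x.length ≤ l}.ncard := fun l =>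
    Set.ncard_le_ncard (fun x hx => ⟨hx.1.1, hx.2⟩)
      ((List.finite_length_le S l).subset fun x hx => hx.2)
  refine (inv_pos.2 hB).trans_le (le_liminf_of_le ?_ ?_)
  -- A real `liminf` is meaningful only for suitably bounded sequences; here the ratios are at most
  -- `1`.
  · refine IsBoundedUnder.isCoboundedUnder_ge ⟨1, eventually_map.2 (Eventually.of_forall fun l => ?_)⟩
    exact div_le_one_of_le₀ (by exact_mod_cast hle l) (by positivity)
  · filter_upwards [eventually_ge_atTop K] with l hl
    have hpos : 0 < {x ∈ Y | x.length ≤ l}.ncard := by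
      refine ((hK l hl).1.trans_le (hloop l hl)).trans_le (Set.ncard_le_ncard
        (fun x hx => ⟨hx.1, hx.2.le⟩) ((List.finite_length_le S l).subset fun x hx => hx.2))
    have hpos' : (0 : ℝ) < {x ∈ M.accepts | x.length ≤ l}.ncard := by
      exact_mod_cast hpos.trans_le (hle l)
    rw [le_div_iff₀ hpos', inv_mul_le_iff₀ hB]
    exact hball l hl
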